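/- For a standard probability space $(X,\mu)$, let $\operatorname{Aut}_{\mathrm{mp}}(X,\mu)$ be the group of measure preserving automorphisms of $(X,\mu)$, identifying two automorphisms that coincide almost everywhere, with the weak topology (the coarsest topology making $T \mapsto \mu(T^{-1}(A) \mathbin{\triangle} B)$ continuous for all measurable $A,B \subset X$). A Polish group $G$ is called a \emph{centralizer group} if there exists an ergodic probability measure preserving action $\Lambda \curvearrowright (X,\mu)$ of a countable group $\Lambda$ on a standard probability space $(X,\mu)$ such that $G$ is isomorphic, as a topological group, with the centralizer of $\Lambda$ inside $\operatorname{Aut}_{\mathrm{mp}}(X,\mu)$. Let $K$ be a compact (Hausdorff) second countable group with Haar probability measure $\lambda$, and let $\operatorname{Aut} K$ be the group of continuous automorphisms of $K$, with the topology inherited from the group of homeomorphisms of $K$ (uniform convergence). Then $\operatorname{Aut} K$ is a centralizer group (in particular, a Polish group). Moreover, put $(X,\mu) = (K,\lambda)^{\mathbb{N}}$ and let $\Lambda < \operatorname{Aut}_{\mathrm{mp}}(X,\mu)$ be the subgroup generated by the group $S_\infty$ of all permutations of $\mathbb{N}$, acting by permuting the coordinates, and the transformation $\theta$ given by $(\theta(x))_1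 = x_1 x_2$ and $(\theta(x))_n = x_n$ for $n \neq 1$. Then $\beta \mapsto \varphi_\beta$, where $(\varphi_\beta(x))_n = \beta(x_n)$, is an isomorphism of topological groups from $\operatorname{Aut} K$ onto the centralizer of $\Lambda$ inside $\operatorname{Aut}_{\mathrm{mp}}(X,\mu)$. -/

import Mathlib

open MeasureTheory
open scoped symmDiff ENNReal

noncomputable section

universe u

/-! ### Measure preserving automorphisms modulo null sets -/

/-- The group of bimeasurable, measure preserving bijections of `X` (no identification yet). -/
def mpPerm {X : Type u} [MeasurableSpace X] (μ : Measure X) : Subgroup (Equiv.Perm X) where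
  carrier := {e | MeasurePreserving e μ μ ∧ MeasurePreserving e.symm μ μ}
  mul_mem' := fun ha hb => ⟨ha.1.comp hb.1, hb.2.comp ha.2⟩
  one_mem' := ⟨MeasurePreserving.id μ, MeasurePreserving.id μ⟩
  inv_mem' := fun ha => ⟨ha.2, ha.1⟩

/-- The normal subgroup of those transformations that are almost everywhere the identity. -/
def aeTrivial {X : Type u} [MeasurableSpace X] (μ : Measure X) : Subgroup (mpPerm μ) where
  carrier := {e | ∀ᵐ x ∂μ, e.1 x = x}
  mul_mem' := by
    intro a b ha hb
    simp only [Set.mem_ofPred_eq] at *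
    filter_upwards [ha, hb] with x hxa hxb
    simp [hxa, hxb]
  one_mem' := by simp
  inv_mem' := by
    intro a ha
    simp only [Set.mem_ofPred_eq] at *
    filter_upwards [ha] with x hx
    exact (Equiv.symm_apply_eq a.1).2 hx.symm

instance aeTrivial_normal {X : Type u} [MeasurableSpace X] (μ : Measure X) :
    (aeTrivial μ).Normal where
  conj_mem := by
    intro n hn g
    have h : ∀ᵐ x ∂μ, n.1 (g.1.symm x) = g.1.symm x :=
      g.2.2.quasiMeasurePreserving.ae hn
    change ∀ᵐ x ∂μ, (g * n * g⁻¹).1 x = x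
    filter_upwards [h] with x hx
    change g.1 (n.1 (g.1.symm x)) = x
    rw [hx, Equiv.apply_symm_apply]

/-- `Aut_mp(X, μ)`: measure preserving automorphisms of `(X, μ)`, two of them being identified
when they coincide almost everywhere. -/
def AutMP {X : Type u} [MeasurableSpace X] (μ : Measure X) : Type u := mpPerm μ ⧸ aeTrivial μ

instance AutMP.instGroup {X : Type u} [MeasurableSpace X] (μ : Measure X) : Group (AutMP μ) :=
  inferInstanceAs (Group (mpPerm μ ⧸ aeTrivial μ))

/-- The class in `Aut_mp(X, μ)` of a measure preserving isomorphism. -/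
def AutMP.mk {X : Type u} [MeasurableSpace X] {μ : Measure X} (e : X ≃ᵐ X)
    (he : MeasurePreserving e μ μ) : AutMP μ :=
  QuotientGroup.mk (s := aeTrivial μ) ⟨e.toEquiv, he, he.symm e⟩

theorem AutMP.measure_preimage_congr {X : Type u} [MeasurableSpace X] {μ : Measure X}
    (A B : Set X) {a b : mpPerm μ} (h : (QuotientGroup.leftRel (aeTrivial μ)).r a b) :
    μ ((a.1 ⁻¹' A) ∆ B) = μ ((b.1 ⁻¹' A) ∆ B) := by
  have h1 : a⁻¹ * b ∈ aeTrivial μ := QuotientGroup.leftRel_apply.1 h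
  have h2 : ∀ᵐ x ∂μ, a.1.symm (b.1 x) = x := h1
  refine measure_congr ?_
  filter_upwards [h2] with x hx
  have hab : b.1 x = a.1 x := (Equiv.symm_apply_eq a.1).1 hx
  refine propext ?_
  change (x ∈ (a.1 ⁻¹' A) ∆ B) ↔ (x ∈ (b.1 ⁻¹' A) ∆ B)
  simp only [Set.mem_symmDiff, Set.mem_preimage, hab]

/-- The function `T ↦ μ (T⁻¹(A) ∆ B)` on `Aut_mp(X, μ)`. -/
def AutMP.dist {X : Type u} [MeasurableSpace X] {μ : Measure X} (A B : Set X) :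
    AutMP μ → ℝ≥0∞ :=
  Quotient.lift (fun T : mpPerm μ => μ ((T.1 ⁻¹' A) ∆ B))
    (fun _ _ h => AutMP.measure_preimage_congr A B h)

/-- The weak topology on `Aut_mp(X, μ)`, i.e. the coarsest topology for which all the maps
`T ↦ T⁻¹(A)` into the measure algebra with its metric `(A, B) ↦ μ (A ∆ B)` are continuous.
As `μ (T⁻¹(A) ∆ B) = μ (A ∆ T(B))`, the maps `T ↦ T(A)` give the same topology. -/
instance AutMP.instTopologicalSpace {X : Type u} [MeasurableSpace X] (μ : Measure X) :
    TopologicalSpace (AutMP μ) :=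
  ⨅ (A : {A : Set X // MeasurableSet A}) (B : {B : Set X // MeasurableSet B}),
    TopologicalSpace.induced (AutMP.dist A.1 B.1) inferInstance

/-! ### Centralizer groups -/

/-- The image in `Aut_mp(X, μ)` of an element of a group that acts on `X` by measure preserving
transformations. -/
def AutMP.ofSMul {X Λ : Type u} [MeasurableSpace X] (μ : Measure X) [Group Λ] [MulAction Λ X]
    [MeasurableConstSMul Λ X] [SMulInvariantMeasure Λ X μ] (g : Λ) : AutMP μ :=
  AutMP.mk (MeasurableEquiv.smul g) (measurePreserving_smul g μ)

/-- A topological group `G` is a centralizer group if it is a Polish group and there is an ergodic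
probability measure preserving action of a countable group `Λ` on a standard probability space
`(X, μ)` such that `G` is isomorphic, as a topological group, with the centralizer of `Λ` inside
`Aut_mp(X, μ)`. -/
def IsCentralizerGroup (G : Type u) [Group G] [TopologicalSpace G] : Prop :=
  IsTopologicalGroup G ∧ PolishSpace G ∧
    ∃ (X : Type u) (_ : MeasurableSpace X) (_ : StandardBorelSpace X)
      (μ : Measure X) (_ : IsProbabilityMeasure μ)
      (Λ : Type u) (_ : Group Λ) (_ : Countable Λ)
      (_ : MulAction Λ X) (_ : MeasurableConstSMul Λ X) (_ : ErgodicSMul Λ X μ),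
      Nonempty (G ≃ₜ* Subgroup.centralizer (Set.range (AutMP.ofSMul (Λ := Λ) μ)))

/-! ### The automorphism group of a topological group -/

/-- The topology on the homeomorphism group of a space for which `f` varies continuously when `f`
and its inverse do so in the compact-open topology. For a compact Hausdorff space this is the
topology of uniform convergence. -/
instance homeoTopology (K : Type u) [TopologicalSpace K] : TopologicalSpace (K ≃ₜ K) :=
  TopologicalSpace.induced (fun f => ((f : C(K, K)), (f.symm : C(K, K)))) inferInstance

/-- `Aut K`: the group of bicontinuous group automorphisms of `K`, as a subgroup of the
homeomorphism group, with the subspace topology. -/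
def autGroup (K : Type u) [Group K] [TopologicalSpace K] : Subgroup (K ≃ₜ K) where
  carrier := {f | ∀ x y, f (x * y) = f x * f y}
  mul_mem' := by
    intro a b ha hb x y
    change a (b (x * y)) = a (b x) * a (b y)
    rw [hb, ha]
  one_mem' := fun _ _ => rfl
  inv_mem' := by
    intro a ha x y
    change a.symm (x * y) = a.symm x * a.symm y
    rw [Homeomorph.symm_apply_eq, ha, a.apply_symm_apply, a.apply_symm_apply]

/-! ### Transformations of `(K, m)^ℕ` -/

/-- The infinite product measure `m^ℕ` on `K^ℕ`. -/
abbrev powMeasure {K : Type u} [MeasurableSpace K] (m : Measure K) [IsProbabilityMeasure m] :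
    Measure (ℕ → K) := Measure.infinitePi (fun _ : ℕ => m)

/-- The permutation of coordinates `(σ x)_n = x_{σ⁻¹(n)}`. -/
def coordPermEquiv (K : Type u) [MeasurableSpace K] (σ : Equiv.Perm ℕ) :
    (ℕ → K) ≃ᵐ (ℕ → K) where
  toFun x := fun n => x (σ.symm n)
  invFun x := fun n => x (σ n)
  left_inv x := by ext n; simp
  right_inv x := by ext n; simp
  measurable_toFun := by dsimp; fun_prop
  measurable_invFun := by dsimp; fun_prop

theorem coordPerm_mp {K : Type u} [MeasurableSpace K] (m : Measure K) [IsProbabilityMeasure m]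
    (σ : Equiv.Perm ℕ) :
    MeasurePreserving (coordPermEquiv K σ) (powMeasure m) (powMeasure m) := by
  refine ⟨(coordPermEquiv K σ).measurable, ?_⟩
  have h := Measure.infinitePi_map_piCongrLeft (X := fun _ : ℕ => K) (fun _ : ℕ => m) σ
  have e : (coordPermEquiv K σ : (ℕ → K) → (ℕ → K)) =
      MeasurableEquiv.piCongrLeft (fun _ : ℕ => K) σ := by
    ext x n
    obtain ⟨k, rfl⟩ := σ.surjective n
    rw [MeasurableEquiv.coe_piCongrLeft, Equiv.piCongrLeft_apply_apply]
    simp [coordPermEquiv]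
  rw [e]
  exact h

/-- The action of the permutations of `ℕ` on `(K, m)^ℕ`. -/
def coordPerm {K : Type u} [MeasurableSpace K] (m : Measure K) [IsProbabilityMeasure m]
    (σ : Equiv.Perm ℕ) : AutMP (powMeasure m) :=
  AutMP.mk (coordPermEquiv K σ) (coordPerm_mp m σ)

/-- The map `θ` that replaces the first coordinate by the product of the first two coordinates and
leaves the other coordinates unchanged. -/
def mulFirstEquiv (K : Type u) [Group K] [MeasurableSpace K] [MeasurableMul₂ K]
    [MeasurableInv K] : (ℕ → K) ≃ᵐ (ℕ → K) where
  toFun x := fun n => if n = 0 then x 0 * x 1 else x n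
  invFun x := fun n => if n = 0 then x 0 * (x 1)⁻¹ else x n
  left_inv x := by
    ext n
    by_cases hn : n = 0 <;> simp [hn]
  right_inv x := by
    ext n
    by_cases hn : n = 0 <;> simp [hn]
  measurable_toFun := by
    refine measurable_pi_iff.2 fun n => ?_
    by_cases hn : n = 0
    · have h : Measurable fun x : ℕ → K => x 0 * x 1 := by fun_prop
      simpa [hn] using h
    · simpa [hn] using measurable_pi_apply n
  measurable_invFun := by
    refine measurable_pi_iff.2 fun n => ?_
    by_cases hn : n = 0
    · have h : Measurable fun x : ℕ → K => x 0 * (x 1)⁻¹ := by fun_prop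
      simpa [hn] using h
    · simpa [hn] using measurable_pi_apply n

/-- Prepending a coordinate. -/
def prependCoord {K : Type u} (p : (ℕ → K) × K) : ℕ → K :=
  fun n => Nat.casesOn n p.2 p.1

theorem prependCoord_measurable {K : Type u} [MeasurableSpace K] :
    Measurable (prependCoord (K := K)) := by
  refine measurable_pi_iff.2 fun n => ?_
  cases n with
  | zero => exact measurable_snd
  | succ n => exact (measurable_pi_apply n).comp measurable_fst

theorem prependCoord_mp {K : Type u} [MeasurableSpace K] (m : Measure K)
    [IsProbabilityMeasure m] :
    MeasurePreserving (prependCoord (K := K)) ((powMeasure m).prod m) (powMeasure m) := by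
  refine ⟨prependCoord_measurable, Measure.eq_infinitePi _ fun s t ht => ?_⟩
  classical
  let t' : ℕ → Set K := fun i => if i ∈ s then t i else Set.univ
  have ht' : ∀ i, MeasurableSet (t' i) := by
    intro i
    by_cases hi : i ∈ s <;> simp [t', hi, ht]
  obtain ⟨N, hN⟩ : ∃ N, s ⊆ Finset.range (N + 1) :=
    ⟨s.sup id, fun i hi => Finset.mem_range.2 (Nat.lt_succ_of_le (Finset.le_sup (f := id) hi))⟩
  have hpre : prependCoord ⁻¹' ((s : Set ℕ).pi t) =
      (((Finset.range N : Finset ℕ) : Set ℕ).pi fun i => t' (i + 1)) ×ˢ t' 0 := by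
    ext p
    simp only [Set.mem_preimage, Set.mem_pi, Set.mem_prod, Finset.mem_coe, Finset.mem_range]
    constructor
    · intro h
      refine ⟨fun i _ => ?_, ?_⟩
      · by_cases hs : i + 1 ∈ s
        · simpa [t', hs, prependCoord] using h _ hs
        · simp [t', hs]
      · by_cases hs : 0 ∈ s
        · simpa [t', hs, prependCoord] using h _ hs
        · simp [t', hs]
    · rintro ⟨h1, h0⟩ i hi
      cases i with
      | zero => simpa [t', hi, prependCoord] using h0
      | succ i =>
        have := h1 i (by simpa using hN hi)
        simpa [t', hi, prependCoord] using this
  rw [Measure.map_apply prependCoord_measurable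
    (MeasurableSet.pi s.countable_toSet fun i _ => ht i), hpre, Measure.prod_prod,
    Measure.infinitePi_pi _ (fun i _ => ht' (i + 1)),
    ← Finset.prod_range_succ' (fun i => m (t' i)) N]
  rw [← Finset.prod_subset hN]
  · exact Finset.prod_congr rfl fun i hi => by simp [t', hi]
  · intro i _ hi
    simp [t', hi]

theorem mulFirst_mp {K : Type u} [Group K] [MeasurableSpace K] [MeasurableMul₂ K]
    [MeasurableInv K] (m : Measure K) [IsProbabilityMeasure m] [m.IsMulRightInvariant] :
    MeasurePreserving (mulFirstEquiv K) (powMeasure m) (powMeasure m) := by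
  have hskew : MeasurePreserving (fun p : (ℕ → K) × K => (id p.1, p.2 * p.1 0))
      ((powMeasure m).prod m) ((powMeasure m).prod m) :=
    (MeasurePreserving.id _).skew_product
      (g := fun (y : ℕ → K) (a : K) => a * y 0)
      (by unfold Function.uncurry; fun_prop)
      (Filter.Eventually.of_forall fun y => map_mul_right_eq_self m (y 0))
  have hcomm : (mulFirstEquiv K : (ℕ → K) → (ℕ → K)) ∘ prependCoord =
      prependCoord ∘ fun p : (ℕ → K) × K => (id p.1, p.2 * p.1 0) := by
    funext p n
    cases n <;> simp [mulFirstEquiv, prependCoord]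
  refine ⟨(mulFirstEquiv K).measurable, ?_⟩
  conv_lhs => rw [← (prependCoord_mp m).map_eq]
  rw [Measure.map_map (mulFirstEquiv K).measurable prependCoord_measurable, hcomm]
  exact ((prependCoord_mp m).comp hskew).map_eq

/-- The element `θ` of `Aut_mp((K, m)^ℕ)`. -/
def mulFirst {K : Type u} [Group K] [MeasurableSpace K] [MeasurableMul₂ K]
    [MeasurableInv K] (m : Measure K) [IsProbabilityMeasure m] [m.IsMulRightInvariant] :
    AutMP (powMeasure m) :=
  AutMP.mk (mulFirstEquiv K) (mulFirst_mp m)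

/-- The diagonal transformation `(φ_α x)_n = α (x_n)`. -/
def diagEquiv {K : Type u} [MeasurableSpace K] (α : K ≃ᵐ K) : (ℕ → K) ≃ᵐ (ℕ → K) where
  toFun x := fun n => α (x n)
  invFun x := fun n => α.symm (x n)
  left_inv x := by ext n; simp
  right_inv x := by ext n; simp
  measurable_toFun := by dsimp; fun_prop
  measurable_invFun := by dsimp; fun_prop

theorem diag_mp {K : Type u} [MeasurableSpace K] {m : Measure K} [IsProbabilityMeasure m]
    (α : K ≃ᵐ K) (hα : MeasurePreserving α m m) :
    MeasurePreserving (diagEquiv α) (powMeasure m) (powMeasure m) := by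
  refine ⟨(diagEquiv α).measurable, ?_⟩
  have h := Measure.infinitePi_map_pi (fun _ : ℕ => m) (f := fun _ : ℕ => (α : K → K))
    (fun _ => α.measurable)
  simp only [hα.map_eq] at h
  exact h

/-- The element `φ_α` of `Aut_mp((K, m)^ℕ)`. -/
def diag {K : Type u} [MeasurableSpace K] {m : Measure K} [IsProbabilityMeasure m]
    (α : K ≃ᵐ K) (hα : MeasurePreserving α m m) : AutMP (powMeasure m) :=
  AutMP.mk (diagEquiv α) (diag_mp α hα)

/-- The Haar probability measure of a compact group is right invariant. -/
instance haar_isMulRightInvariant {K : Type u} [Group K] [TopologicalSpace K]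
    [IsTopologicalGroup K] [CompactSpace K] [MeasurableSpace K] [BorelSpace K]
    (m : Measure K) [m.IsHaarMeasure] [IsProbabilityMeasure m] : m.IsMulRightInvariant where
  map_mul_right_eq_self g := by
    have : IsProbabilityMeasure (m.map (· * g)) :=
      Measure.isProbabilityMeasure_map (measurable_mul_const g).aemeasurable
    exact Measure.isHaarMeasure_eq_of_isProbabilityMeasure _ m

theorem autGroup_mp {K : Type u} [Group K] [TopologicalSpace K]
    [IsTopologicalGroup K] [CompactSpace K] [MeasurableSpace K] [BorelSpace K]
    (m : Measure K) [m.IsHaarMeasure] [IsProbabilityMeasure m] (β : autGroup K) :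
    MeasurePreserving β.1.toMeasurableEquiv m m := by
  refine ⟨β.1.toMeasurableEquiv.measurable, ?_⟩
  have h1 : IsProbabilityMeasure (m.map β.1.toMeasurableEquiv) :=
    Measure.isProbabilityMeasure_map β.1.toMeasurableEquiv.measurable.aemeasurable
  have h2 : (m.map β.1.toMeasurableEquiv).IsHaarMeasure :=
    MulEquiv.isHaarMeasure_map m (MulEquiv.mk β.1.toEquiv β.2) β.1.continuous
      β.1.symm.continuous
  exact Measure.isHaarMeasure_eq_of_isProbabilityMeasure _ m

/-- The diagonal transformation of `(K, m)^ℕ` given by a continuous automorphism of `K`, where `m`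
is the Haar probability measure. -/
def autDiag {K : Type u} [Group K] [TopologicalSpace K]
    [IsTopologicalGroup K] [CompactSpace K] [MeasurableSpace K] [BorelSpace K]
    (m : Measure K) [m.IsHaarMeasure] [IsProbabilityMeasure m] (β : autGroup K) :
    AutMP (powMeasure m) :=
  diag β.1.toMeasurableEquiv (autGroup_mp m β)

/-- The subgroup of `Aut_mp((K, m)^ℕ)` generated by all permutations of the coordinates and `θ`. -/
def permMulGroup {K : Type u} [Group K] [MeasurableSpace K] [MeasurableMul₂ K]
    [MeasurableInv K] (m : Measure K) [IsProbabilityMeasure m] [m.IsMulRightInvariant] :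
    Subgroup (AutMP (powMeasure m)) :=
  Subgroup.closure (Set.range (coordPerm m) ∪ {mulFirst m})

end

/-! Let `T` commute with the transpositions of coordinates. Then `T x 0` is invariant under
transpositions of the nonzero coordinates, and a Hewitt–Savage argument
(`exists_eq_comp_eval_zero_of_swap_invariant`) shows that it is a function `α (x 0)`; conjugating by
transpositions gives `T x n = α (x n)` for all `n`. Commutation with `θ` says that `α` is
multiplicative almost everywhere, so `α` agrees almost everywhere with a continuous homomorphism
(`exists_continuous_monoidHom_ae_eq`). The same applied to `T⁻¹` provides the inverse homomorphism.

For the topologies, uniform convergence of automorphisms gives weak convergence of the diagonal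
maps. Conversely, weak convergence gives convergence in measure on `K`, which for automorphisms is
already uniform (`tendsto_autGroup_of_tendsto_measure`).

Only transpositions and `θ` were used. They generate a countable group, which acts ergodically by
the same Hewitt–Savage argument and has the same centralizer; this makes `Aut K` a centralizer
group. -/

/-! ### Independence of coordinates in the product measure -/

theorem MeasureTheory.MeasurePreserving.ae_eq_of_ae_eq_comp {α β γ : Type*} [MeasurableSpace α]
    [MeasurableSpace β] [MeasurableSpace γ] [MeasurableEq γ] {μ : Measure α} {ν : Measure β}
    {f : α → β} (hf : MeasurePreserving f μ ν) {u v : β → γ} (hu : Measurable u)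
    (hv : Measurable v) (h : ∀ᵐ x ∂μ, u (f x) = v (f x)) : ∀ᵐ y ∂ν, u y = v y := by
  rw [← hf.map_eq]
  exact (ae_map_iff hf.measurable.aemeasurable (measurableSet_eq_fun hu hv)).2 h

theorem powMeasure_reindex_mp {K : Type u} [MeasurableSpace K] (m : Measure K)
    [IsProbabilityMeasure m] {f : ℕ → ℕ} (hf : f.Injective) :
    MeasurePreserving (fun x : ℕ → K => x ∘ f) (powMeasure m) (powMeasure m) :=
  ⟨by unfold Function.comp; fun_prop,
    Measure.map_infinitePi_infinitePi_of_inj (P := fun _ : ℕ => m) hf⟩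

open ProbabilityTheory in
/-- Two disjoint families of coordinates are independent. -/
theorem powMeasure_reindex_prod_mp {K : Type u} [MeasurableSpace K] (m : Measure K)
    [IsProbabilityMeasure m] {f g : ℕ → ℕ} (hf : f.Injective) (hg : g.Injective)
    (hfg : Disjoint (Set.range f) (Set.range g)) :
    MeasurePreserving (fun x : ℕ → K => (x ∘ f, x ∘ g)) (powMeasure m)
      ((powMeasure m).prod (powMeasure m)) := by
  have hF := powMeasure_reindex_mp m hf
  have hG := powMeasure_reindex_mp m hg
  refine ⟨hF.measurable.prodMk hG.measurable, ?_⟩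
  have hind : iIndep (fun n : ℕ => MeasurableSpace.comap (fun x : ℕ → K => x n) inferInstance)
      (powMeasure m) :=
    iIndepFun_infinitePi (P := fun _ : ℕ => m) (X := fun _ x => x) fun _ => measurable_id
  have h := indep_iSup_of_disjoint (fun n => (measurable_pi_apply n).comap_le) hind hfg
  have hle : ∀ k : ℕ → ℕ, MeasurableSpace.comap (fun x : ℕ → K => x ∘ k) inferInstance ≤
      ⨆ i ∈ Set.range k, MeasurableSpace.comap (fun x : ℕ → K => x i) inferInstance := by
    intro k
    simp only [MeasurableSpace.pi, MeasurableSpace.comap_iSup, MeasurableSpace.comap_comp]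
    exact iSup_le fun n => le_iSup₂_of_le (k n) ⟨n, rfl⟩ le_rfl
  have hi : IndepFun (fun x : ℕ → K => x ∘ f) (fun x : ℕ → K => x ∘ g) (powMeasure m) :=
    indep_of_indep_of_le_left (indep_of_indep_of_le_right h (hle g)) (hle f)
  rw [(indepFun_iff_map_prod_eq_prod_map_map hF.measurable.aemeasurable
    hG.measurable.aemeasurable).1 hi, hF.map_eq, hG.map_eq]

theorem powMeasure_eval_mp {K : Type u} [MeasurableSpace K] (m : Measure K)
    [IsProbabilityMeasure m] (n : ℕ) :
    MeasurePreserving (fun x : ℕ → K => x n) (powMeasure m) m :=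
  ⟨measurable_pi_apply n, Measure.infinitePi_map_eval (fun _ : ℕ => m) n⟩

open ProbabilityTheory in
theorem powMeasure_eval_pair_mp {K : Type u} [MeasurableSpace K] (m : Measure K)
    [IsProbabilityMeasure m] {i j : ℕ} (hij : i ≠ j) :
    MeasurePreserving (fun x : ℕ → K => (x i, x j)) (powMeasure m) (m.prod m) := by
  have he := powMeasure_eval_mp m
  refine ⟨(he i).measurable.prodMk (he j).measurable, ?_⟩
  have hind : IndepFun (fun x : ℕ → K => x i) (fun x : ℕ → K => x j) (powMeasure m) :=
    (iIndepFun_infinitePi (P := fun _ : ℕ => m) (X := fun _ x => x)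
      fun _ => measurable_id).indepFun hij
  rw [(indepFun_iff_map_prod_eq_prod_map_map (he i).measurable.aemeasurable
    (he j).measurable.aemeasurable).1 hind, (he i).map_eq, (he j).map_eq]

/-! ### Functions invariant under transpositions (Hewitt–Savage) -/

/-- Reindexing `x ↦ x ∘ f`, as a continuous map. -/
def reindexMap (K : Type u) [TopologicalSpace K] (f : ℕ → ℕ) : C(ℕ → K, ℕ → K) :=
  ⟨fun x => x ∘ f, by unfold Function.comp; fun_prop⟩

/-- Joint continuity in `f` and `x` suffices, and it holds because `f n` is locally constant in `f`,
`ℕ` being discrete. -/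
theorem continuous_reindexMap (K : Type u) [TopologicalSpace K] :
    Continuous (reindexMap K) := by
  refine ContinuousMap.continuous_of_continuous_uncurry _ ?_
  refine continuous_pi fun n => continuous_iff_continuousAt.2 fun p => ?_
  have h : ∀ᶠ q : (ℕ → ℕ) × (ℕ → K) in nhds p, q.1 n = p.1 n :=
    ((continuous_apply n).comp continuous_fst).continuousAt (isOpen_discrete {p.1 n} |>.mem_nhds rfl)
  refine ContinuousAt.congr (f := fun q : (ℕ → ℕ) × (ℕ → K) => q.2 (p.1 n)) (by fun_prop) ?_
  filter_upwards [h] with q hq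
  simp [reindexMap, Function.uncurry, hq]

/-- If `F` is invariant under the transpositions of the nonzero coordinates, then every injection
fixing `0` agrees on any initial segment with a permutation leaving `F` invariant. -/
theorem exists_perm_eq_on_of_swap_invariant {K : Type u} {Z : Type*} [MeasurableSpace K]
    (m : Measure K) [IsProbabilityMeasure m] {F : (ℕ → K) → Z}
    (hinv : ∀ i j : ℕ, i ≠ 0 → j ≠ 0 →
      (fun x => F (x ∘ Equiv.swap i j)) =ᵐ[powMeasure m] F)
    {f : ℕ → ℕ} (hf : f.Injective) (hf0 : f 0 = 0) (N : ℕ) :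
    ∃ σ : Equiv.Perm ℕ, (∀ j ≤ N, σ j = f j) ∧ (fun x => F (x ∘ σ)) =ᵐ[powMeasure m] F := by
  induction N with
  | zero => exact ⟨1, by simp [hf0], Filter.EventuallyEq.rfl⟩
  | succ N ih =>
    obtain ⟨σ, hσ, hFσ⟩ := ih
    have h0 : σ 0 = 0 := by rw [hσ 0 (Nat.zero_le N), hf0]
    have h1 : σ (N + 1) ≠ 0 := fun h => by
      simpa using σ.injective (h.trans h0.symm)
    have h2 : f (N + 1) ≠ 0 := fun h => by
      simpa using hf (h.trans hf0.symm)
    -- The transposition corrects the value at `N + 1`; by injectivity it moves none of the values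
    -- already matched. Both its entries are nonzero, so `hinv` applies to it.
    refine ⟨Equiv.swap (σ (N + 1)) (f (N + 1)) * σ, fun j hj => ?_, ?_⟩
    · rcases Nat.lt_or_eq_of_le hj with hj | rfl
      · have hj' := hσ j (Nat.lt_succ_iff.1 hj)
        rw [Equiv.Perm.mul_apply, Equiv.swap_apply_of_ne_of_ne, hj']
        · exact fun h => hj.ne (σ.injective h)
        · exact fun h => hj.ne (hf (hj'.symm.trans h))
      · simp
    · have hq := (powMeasure_reindex_mp m
        (Equiv.swap (σ (N + 1)) (f (N + 1))).injective).quasiMeasurePreserving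
      exact (hq.ae_eq_comp hFσ).trans (hinv _ _ h1 h2)

/-- An injection fixing `0` is a pointwise limit of permutations that leave `F` invariant, and the
injections preserving a given measurable set modulo null sets form a closed set. Passing to
injections is the point: they can discard coordinates, which permutations cannot. -/
theorem reindex_invariant_of_swap_invariant {K : Type u} {Z : Type*} [TopologicalSpace K]
    [CompactSpace K] [T2Space K] [SecondCountableTopology K] [MeasurableSpace K] [BorelSpace K] (m : Measure K)
    [IsProbabilityMeasure m] [MeasurableSpace Z] [MeasurableSpace.CountablySeparated Z]
    {F : (ℕ → K) → Z} (hF : Measurable F)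
    (hinv : ∀ i j : ℕ, i ≠ 0 → j ≠ 0 →
      (fun x => F (x ∘ Equiv.swap i j)) =ᵐ[powMeasure m] F)
    {f : ℕ → ℕ} (hf : f.Injective) (hf0 : f 0 = 0) :
    (fun x => F (x ∘ f)) =ᵐ[powMeasure m] F := by
  refine Filter.EventuallyEq.of_forall_separating_preimage MeasurableSet fun U hU => ?_
  have hcl := isClosed_setOfPred_preimage_ae_eq (μ := powMeasure m) (ν := powMeasure m)
    (Z := {f : ℕ → ℕ // f.Injective}) (f := fun f => reindexMap K f.1)
    ((continuous_reindexMap K).comp continuous_subtype_val)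
    (fun f => powMeasure_reindex_mp m f.2) (F ⁻¹' U) (hF hU).nullMeasurableSet (measure_ne_top _ _)
  choose σ hσ hFσ using exists_perm_eq_on_of_swap_invariant m hinv hf hf0
  have hlim : Filter.Tendsto (fun N => (⟨σ N, (σ N).injective⟩ : {f : ℕ → ℕ // f.Injective}))
      Filter.atTop (nhds ⟨f, hf⟩) := by
    rw [tendsto_subtype_rng, tendsto_pi_nhds]
    intro j
    refine tendsto_const_nhds.congr' ?_
    filter_upwards [Filter.eventually_ge_atTop j] with N hN
    exact (hσ N j hN).symm
  exact hcl.mem_of_tendsto hlim (Filter.Eventually.of_forall fun N => by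
    filter_upwards [hFσ N] with x hx
    exact congrArg U hx)

/-- A function on `K^ℕ` that is invariant under the permutations of the nonzero coordinates only
depends on the coordinate `0`. -/
theorem exists_eq_comp_eval_zero_of_swap_invariant {K : Type u} {Z : Type*} [TopologicalSpace K]
    [CompactSpace K] [T2Space K] [SecondCountableTopology K] [MeasurableSpace K] [BorelSpace K]
    (m : Measure K) [IsProbabilityMeasure m] [MeasurableSpace Z]
    [MeasurableSpace.CountablySeparated Z] [MeasurableEq Z]
    {F : (ℕ → K) → Z} (hF : Measurable F)
    (hinv : ∀ i j : ℕ, i ≠ 0 → j ≠ 0 →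
      (fun x => F (x ∘ Equiv.swap i j)) =ᵐ[powMeasure m] F) :
    ∃ α : K → Z, Measurable α ∧ ∀ᵐ x ∂powMeasure m, F x = α (x 0) := by
  let e : ℕ → ℕ := fun n => 2 * n
  let o : ℕ → ℕ := fun n => 2 * n + 1
  let G : (ℕ → K) × K → Z := fun p => F (prependCoord p)
  have hG : Measurable G := hF.comp prependCoord_measurable
  have hlift : ∀ k : ℕ → ℕ, k.Injective →
      ∀ᵐ p ∂(powMeasure m).prod m, G (p.1 ∘ k, p.2) = G p := by
    intro k hk
    -- `k'` fixes the prepended coordinate and acts as `k` on the remaining ones.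
    let k' : ℕ → ℕ := fun n => Nat.casesOn n 0 fun n => k n + 1
    have hk' : k'.Injective := by
      intro a b hab
      cases a <;> cases b <;> simp [k'] at hab ⊢
      exact hk hab
    have h := reindex_invariant_of_swap_invariant m hF hinv hk' rfl
    filter_upwards [(prependCoord_mp m).quasiMeasurePreserving.ae h] with p hp
    exact (congrArg F (funext fun n => by cases n <;> rfl)).trans hp
  have he : e.Injective := fun a b h => by simpa [e] using h
  have ho : o.Injective := fun a b h => by simpa [o] using h
  have heo : Disjoint (Set.range e) (Set.range o) := by
    rw [Set.disjoint_left]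
    rintro _ ⟨a, rfl⟩ ⟨b, hb⟩
    simp only [e, o] at hb
    omega
  -- With coordinate `0` split off, `G` can be computed from the even coordinates alone and from the
  -- odd ones alone. These are independent, so `G` agrees at two independent sequences, and Fubini
  -- allows one of them to be frozen.
  have hmp := (powMeasure_reindex_prod_mp m he ho heo).prod (MeasurePreserving.id m)
  have hall : ∀ᵐ p ∂((powMeasure m).prod (powMeasure m)).prod m,
      G (p.1.1, p.2) = G (p.1.2, p.2) := by
    refine hmp.ae_eq_of_ae_eq_comp (u := fun p => G (p.1.1, p.2)) (v := fun p => G (p.1.2, p.2))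
      (by fun_prop) (by fun_prop) ?_
    filter_upwards [hlift e he, hlift o ho] with p h1 h2
    exact h1.trans h2.symm
  have hall' : ∀ᵐ q ∂(powMeasure m).prod ((powMeasure m).prod m),
      G (q.2.1, q.2.2) = G (q.1, q.2.2) := by
    let r : (ℕ → K) × (ℕ → K) × K → ((ℕ → K) × (ℕ → K)) × K := fun q => ((q.2.1, q.1), q.2.2)
    have hr : MeasurePreserving r ((powMeasure m).prod ((powMeasure m).prod m))
        (((powMeasure m).prod (powMeasure m)).prod m) :=
      ((Measure.measurePreserving_swap (μ := powMeasure m) (ν := powMeasure m)).prod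
        (MeasurePreserving.id m)).comp
        (measurePreserving_prodAssoc (powMeasure m) (powMeasure m) m).symm
    exact hr.quasiMeasurePreserving.ae hall
  obtain ⟨y, hy⟩ := (Measure.ae_ae_of_ae_prod hall').exists
  have hα : Measurable fun t => G (y, t) := hG.comp (by fun_prop)
  refine ⟨fun t => G (y, t), hα, ?_⟩
  refine (prependCoord_mp m).ae_eq_of_ae_eq_comp (v := fun x => G (y, x 0)) hF
    (hα.comp (measurable_pi_apply 0)) ?_
  filter_upwards [hy] with p hp
  exact hp

/-- The finite permutations of the coordinates act ergodically on `K^ℕ`. -/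
theorem eventuallyConst_of_swap_invariant {K : Type u} [TopologicalSpace K]
    [CompactSpace K] [T2Space K] [SecondCountableTopology K] [MeasurableSpace K] [BorelSpace K]
    (m : Measure K) [IsProbabilityMeasure m] {s : Set (ℕ → K)} (hs : MeasurableSet s)
    (hinv : ∀ i j : ℕ, (fun x : ℕ → K => x ∘ Equiv.swap i j) ⁻¹' s =ᵐ[powMeasure m] s) :
    Filter.EventuallyConst s (ae (powMeasure m)) := by
  obtain ⟨α, hα, h⟩ := exists_eq_comp_eval_zero_of_swap_invariant m
    (F := fun x => x ∈ s) (measurable_mem.2 hs) fun i j _ _ => hinv i j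
  have hq := (powMeasure_reindex_mp m (Equiv.swap 0 1).injective).quasiMeasurePreserving
  -- Membership in `s` depends on `x 0` only and, by invariance under swapping `0` and `1`, equally
  -- on `x 1`; independence makes `α` constant.
  have h01 : ∀ᵐ p ∂m.prod m, α p.1 = α p.2 := by
    refine (powMeasure_eval_pair_mp m zero_ne_one).ae_eq_of_ae_eq_comp
      (u := fun p => α p.1) (v := fun p => α p.2) (by fun_prop) (by fun_prop) ?_
    filter_upwards [h, hq.ae h, hinv 0 1] with x h1 h2 h3
    have h4 : (x ∘ Equiv.swap 0 1 ∈ s) = α (x 1) := by simpa using h2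
    exact h1.symm.trans (h3.symm.trans h4)
  obtain ⟨a, ha⟩ := (Measure.ae_ae_of_ae_prod h01).exists
  have hc : ∀ᵐ x ∂powMeasure m, (x ∈ s) = α a := by
    filter_upwards [h, (powMeasure_eval_mp m 0).quasiMeasurePreserving.ae ha] with x h1 h2
    exact h1.trans h2.symm
  rw [Filter.eventuallyConst_set]
  by_cases h' : α a
  · exact Or.inl (hc.mono fun x hx => hx.symm ▸ h')
  · exact Or.inr (hc.mono fun x hx => hx.symm ▸ h')

/-! ### Automatic continuity and convergence in measure for homomorphisms -/

open Filter Topology Pointwise in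
/-- A measurable map that is almost everywhere multiplicative agrees almost everywhere with a
continuous homomorphism. -/
theorem exists_continuous_monoidHom_ae_eq {K : Type u} [Group K] [TopologicalSpace K]
    [IsTopologicalGroup K] [CompactSpace K] [T2Space K] [SecondCountableTopology K]
    [MeasurableSpace K] [BorelSpace K] (m : Measure K) [m.IsHaarMeasure] [IsProbabilityMeasure m]
    {α : K → K} (hα : Measurable α)
    (hmul : ∀ᵐ p ∂m.prod m, α (p.1 * p.2) = α p.1 * α p.2) :
    ∃ β : K →* K, Continuous β ∧ ∀ᵐ x ∂m, α x = β x := by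
  have htrans : ∀ (a : K) {p : K → Prop}, (∀ᵐ y ∂m, p y) → ∀ᵐ y ∂m, p (a * y) := fun a p hp =>
    (measurePreserving_mul_left m a).quasiMeasurePreserving.ae hp
  -- `P x c` determines the value `c` of the sought homomorphism at every point `x`, not just at
  -- almost every one.
  let P : K → K → Prop := fun x c => ∀ᵐ y ∂m, α (x * y) = c * α y
  have huniq : ∀ x c d, P x c → P x d → c = d := by
    intro x c d hc hd
    obtain ⟨y, h1, h2⟩ := (hc.and hd).exists
    exact mul_right_cancel (h1.symm.trans h2)
  have hPmul : ∀ x y c d, P x c → P y d → P (x * y) (c * d) := by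
    intro x y c d hc hd
    filter_upwards [htrans y hc, hd] with z h1 h2
    rw [mul_assoc, h1, h2, mul_assoc]
  have hPinv : ∀ x c, P x c → P x⁻¹ c⁻¹ := by
    intro x c hc
    filter_upwards [htrans x⁻¹ hc] with z h1
    rw [mul_inv_cancel_left] at h1
    rw [h1, inv_mul_cancel_left]
  have hPα : ∀ᵐ x ∂m, P x (α x) := Measure.ae_ae_of_ae_prod hmul
  have hex : ∀ x, ∃ c, P x c := by
    intro x
    -- Every `x` is a quotient `a * (x⁻¹ * a)⁻¹` of two points of the conull set where `P` holds
    -- with value `α`.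
    obtain ⟨a, h1, h2⟩ := (hPα.and (htrans x⁻¹ hPα)).exists
    refine ⟨α a * (α (x⁻¹ * a))⁻¹, ?_⟩
    have h3 := hPmul _ _ _ _ h1 (hPinv _ _ h2)
    rwa [show a * (x⁻¹ * a)⁻¹ = x by group] at h3
  choose β hβ using hex
  let βh : K →* K := MonoidHom.mk' β fun x y =>
    huniq _ _ _ (hβ (x * y)) (hPmul _ _ _ _ (hβ x) (hβ y))
  have hae : ∀ᵐ x ∂m, α x = βh x := hPα.mono fun x hx => huniq _ _ _ hx (hβ x)
  refine ⟨βh, continuous_of_continuousAt_one βh ?_, hae⟩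
  rw [ContinuousAt, map_one]
  intro U hU
  obtain ⟨V, hV, hVU⟩ := exists_nhds_split_inv hU
  obtain ⟨S, hS, hSm, hSe⟩ := hae.exists_measurable_mem
  have : IsProbabilityMeasure (m.map α) := Measure.isProbabilityMeasure_map hα.aemeasurable
  -- Steinhaus–Weil argument: `c` lies in the support of the law of `α`, so the set `E` where `α` is
  -- near `c` and equals `βh` has positive measure. Hence `E / E` is a neighbourhood of `1`, and
  -- `βh` maps it into `U`.
  obtain ⟨c, -, hc⟩ := exists_mem_forall_mem_nhdsWithin_pos_measure (μ := m.map α)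
    (s := Set.univ) (by simp)
  let O : Set K := (fun x => x * c⁻¹) ⁻¹' interior V
  have hOo : IsOpen O := isOpen_interior.preimage (continuous_mul_const _)
  have hcO : O ∈ 𝓝 c := hOo.mem_nhds (by
    simpa [O] using mem_interior_iff_mem_nhds.2 hV)
  have hpos : 0 < m (α ⁻¹' O ∩ S) := by
    rw [measure_inter_conull (mem_ae_iff.1 hS),
      ← Measure.map_apply hα hOo.measurableSet]
    exact hc O (by simpa using hcO)
  have hE := Measure.div_mem_nhds_one_of_haar_pos_ne_top m _ ((hα hOo.measurableSet).inter hSm) hpos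
    (measure_ne_top _ _)
  refine mem_map.2 (mem_of_superset hE ?_)
  rintro _ ⟨a, ⟨haO, haS⟩, b, ⟨hbO, hbS⟩, rfl⟩
  have h := hVU _ (interior_subset haO) _ (interior_subset hbO)
  rw [Set.mem_preimage, map_div, ← hSe a haS, ← hSe b hbS]
  simpa using h

open Filter Topology in
/-- Continuous automorphisms of a compact group that converge in measure converge uniformly. -/
theorem tendsto_autGroup_of_tendsto_measure {K : Type u} [Group K] [TopologicalSpace K]
    [IsTopologicalGroup K] [CompactSpace K] [MeasurableSpace K] [BorelSpace K]
    (m : Measure K) [m.IsHaarMeasure] [IsProbabilityMeasure m] {ι : Type*} {l : Filter ι}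
    {f : ι → autGroup K} {g : autGroup K}
    (h : ∀ A : Set K, MeasurableSet A →
      Tendsto (fun i => m (((f i).1 ⁻¹' A) ∆ (g.1 ⁻¹' A))) l (𝓝 0)) :
    Tendsto (fun i => ((f i).1 : C(K, K))) l (𝓝 (g.1 : C(K, K))) := by
  let _ := IsTopologicalGroup.rightUniformSpace K
  rw [ContinuousMap.tendsto_iff_tendstoUniformly, IsTopologicalGroup.tendstoUniformly_iff _ _ _ rfl]
  intro U hU
  -- Compactness of `K` makes `W` uniform over all conjugating elements `k`.
  obtain ⟨W, hW, hWU⟩ : ∃ W ∈ 𝓝 (1 : K), ∀ a ∈ W, ∀ b ∈ W, ∀ k : K,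
      a * (k * b⁻¹ * k⁻¹) ∈ U := by
    have hev : ∀ᶠ p : K × K in 𝓝 (1, 1), ∀ k ∈ (Set.univ : Set K),
        p.1 * (k * p.2⁻¹ * k⁻¹) ∈ U := by
      refine isCompact_univ.eventually_forall_of_forall_eventually fun k _ => ?_
      have hcont : Continuous fun z : (K × K) × K => z.1.1 * (z.2 * z.1.2⁻¹ * z.2⁻¹) := by
        fun_prop
      exact hcont.continuousAt (by simpa using hU)
    rw [nhds_prod_eq] at hev
    obtain ⟨W, hW, hWs⟩ := Filter.mem_prod_self_iff.1 hev
    exact ⟨W, hW, fun a ha b hb k => hWs (Set.mk_mem_prod ha hb) k (Set.mem_univ k)⟩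
  obtain ⟨V, hV, hVW⟩ := exists_nhds_split_inv hW
  let A : K → Set K := fun x => (fun y => y * x⁻¹) ⁻¹' interior V
  have hAo : ∀ x, IsOpen (A x) := fun x => isOpen_interior.preimage (continuous_mul_const _)
  have hA : ∀ x, A x ∈ 𝓝 x := fun x => (hAo x).mem_nhds (by
    simpa [A] using mem_interior_iff_mem_nhds.2 hV)
  obtain ⟨t, -, ht⟩ := isCompact_univ.elim_nhds_subcover A fun x _ => hA x
  have hsum : Tendsto (fun i => ∑ x ∈ t, m (((f i).1 ⁻¹' A x) ∆ (g.1 ⁻¹' A x))) l (𝓝 0) := by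
    simpa using tendsto_finsetSum t fun x _ => h (A x) (hAo x).measurableSet
  -- Below measure `1/2`, the bad set `D` and its translate cannot cover `K`, so some `z` has both
  -- `z` and `x * z` good.
  filter_upwards [hsum.eventually_lt_const (show (0 : ℝ≥0∞) < 2⁻¹ by simp)] with i hi x
  let D : Set K := ⋃ y ∈ t, ((f i).1 ⁻¹' A y) ∆ (g.1 ⁻¹' A y)
  have hD : m D < 2⁻¹ := (measure_biUnion_finset_le _ _).trans_lt hi
  have hDC : ∀ y ∉ D, (f i).1 y / g.1 y ∈ W := by
    intro y hy
    obtain ⟨k, hk, hky⟩ := Set.mem_iUnion₂.1 (ht (Set.mem_univ (g.1 y)))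
    have hyk : (f i).1 y ∈ A k := by
      by_contra hn
      exact hy (Set.mem_iUnion₂.2 ⟨k, hk, Or.inr ⟨hky, hn⟩⟩)
    simpa using hVW _ (interior_subset hyk) _ (interior_subset hky)
  obtain ⟨z, hz⟩ : ∃ z, z ∉ D ∪ (x * ·) ⁻¹' D := by
    by_contra! hall
    have h1 : m (D ∪ (x * ·) ⁻¹' D) = 1 := by
      rw [Set.eq_univ_of_forall hall, measure_univ]
    have h2 : m (D ∪ (x * ·) ⁻¹' D) < 1 := by
      refine (measure_union_le _ _).trans_lt ?_
      rw [measure_preimage_mul, ← ENNReal.inv_two_add_inv_two]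
      exact ENNReal.add_lt_add hD hD
    exact h2.ne h1
  have hz1 := hDC z fun hn => hz (Or.inl hn)
  have hz2 := hDC (x * z) fun hn => hz (Or.inr hn)
  -- With `d y = f y * (g y)⁻¹`, multiplicativity gives `d x = d (x * z) * (g x * (d z)⁻¹ * (g
  -- x)⁻¹)`.
  have := hWU _ hz2 _ hz1 (g.1 x)
  rw [(f i).2, g.2] at this
  change (f i).1 x / g.1 x ∈ U
  convert this using 1
  simp only [div_eq_mul_inv]
  group

/-! ### `Aut K` as a Polish group -/

/-- The map `f ↦ (f, f⁻¹)` that defines the topology of `Aut K`. -/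
def autGroupToProd (K : Type u) [Group K] [TopologicalSpace K] (f : autGroup K) :
    C(K, K) × C(K, K) :=
  ((f.1 : C(K, K)), (f.1.symm : C(K, K)))

theorem isInducing_autGroupToProd (K : Type u) [Group K] [TopologicalSpace K] :
    Topology.IsInducing (autGroupToProd K) :=
  (Topology.IsInducing.mk rfl :
    Topology.IsInducing fun f : K ≃ₜ K => ((f : C(K, K)), (f.symm : C(K, K)))).comp
    Topology.IsInducing.subtypeVal

theorem autGroup_isTopologicalGroup (K : Type u) [Group K] [TopologicalSpace K]
    [LocallyCompactSpace K] : IsTopologicalGroup (autGroup K) where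
  continuous_mul := by
    have h := (isInducing_autGroupToProd K).continuous
    refine (isInducing_autGroupToProd K).continuous_iff.2 (Continuous.prodMk ?_ ?_)
    · exact Continuous.compCM (h.comp continuous_fst).fst (h.comp continuous_snd).fst
    · exact Continuous.compCM (h.comp continuous_snd).snd (h.comp continuous_fst).snd
  continuous_inv := by
    have h := (isInducing_autGroupToProd K).continuous
    exact (isInducing_autGroupToProd K).continuous_iff.2 (h.snd.prodMk h.fst)

/-- The image is cut out by closed conditions: the two maps are mutually inverse, and the first is
multiplicative. Local compactness makes composition continuous. -/
theorem isClosedEmbedding_autGroupToProd (K : Type u) [Group K] [TopologicalSpace K]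
    [IsTopologicalGroup K] [LocallyCompactSpace K] [T2Space K] :
    Topology.IsClosedEmbedding (autGroupToProd K) := by
  refine ⟨⟨isInducing_autGroupToProd K, fun f g hfg => ?_⟩, ?_⟩
  · ext x
    exact DFunLike.congr_fun (congrArg Prod.fst hfg) x
  · have hr : Set.range (autGroupToProd K) =
        {p | p.1.comp p.2 = ContinuousMap.id K} ∩ {p | p.2.comp p.1 = ContinuousMap.id K} ∩
          ⋂ (x : K) (y : K), {p | p.1 (x * y) = p.1 x * p.1 y} := by
      ext p
      constructor
      · rintro ⟨f, rfl⟩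
        refine ⟨⟨?_, ?_⟩, ?_⟩
        · ext x
          exact f.1.apply_symm_apply x
        · ext x
          exact f.1.symm_apply_apply x
        · exact Set.mem_iInter₂.2 fun x y => f.2 x y
      · rintro ⟨⟨h1, h2⟩, h3⟩
        exact ⟨⟨⟨⟨p.1, p.2, DFunLike.congr_fun h2, DFunLike.congr_fun h1⟩,
          p.1.continuous, p.2.continuous⟩, fun x y => Set.mem_iInter₂.1 h3 x y⟩, rfl⟩
    rw [hr]
    refine ((isClosed_eq ?_ ?_).inter (isClosed_eq ?_ ?_)).inter
      (isClosed_iInter fun x => isClosed_iInter fun y => isClosed_eq ?_ ?_)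
    · exact continuous_fst.compCM continuous_snd
    · exact continuous_const
    · exact continuous_snd.compCM continuous_fst
    · exact continuous_const
    · exact (continuous_eval_const _).comp continuous_fst
    · exact ((continuous_eval_const _).comp continuous_fst).mul
        ((continuous_eval_const _).comp continuous_fst)

theorem autGroup_polishSpace (K : Type u) [Group K] [TopologicalSpace K]
    [IsTopologicalGroup K] [CompactSpace K] [T2Space K] [SecondCountableTopology K] :
    PolishSpace (autGroup K) := by
  let _ := TopologicalSpace.metrizableSpaceMetric K
  exact (isClosedEmbedding_autGroupToProd K).polishSpace

/-! ### The centralizer as an abstract group -/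

theorem AutMP.mk_eq_mk_iff {X : Type u} [MeasurableSpace X] {μ : Measure X} {a b : mpPerm μ} :
    (QuotientGroup.mk (s := aeTrivial μ) a : AutMP μ) = QuotientGroup.mk (s := aeTrivial μ) b ↔
      ∀ᵐ x ∂μ, a.1 x = b.1 x := by
  refine QuotientGroup.eq.trans ?_
  change (∀ᵐ x ∂μ, a.1.symm (b.1 x) = x) ↔ _
  refine Filter.eventually_congr (Filter.Eventually.of_forall fun x => ?_)
  rw [Equiv.symm_apply_eq, eq_comm]

theorem AutMP.commute_mk_iff {X : Type u} [MeasurableSpace X] {μ : Measure X} {a b : mpPerm μ} :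
    (QuotientGroup.mk (s := aeTrivial μ) a : AutMP μ) * QuotientGroup.mk (s := aeTrivial μ) b =
        (QuotientGroup.mk (s := aeTrivial μ) b : AutMP μ) * QuotientGroup.mk (s := aeTrivial μ) a ↔
      ∀ᵐ x ∂μ, a.1 (b.1 x) = b.1 (a.1 x) :=
  AutMP.mk_eq_mk_iff (a := a * b) (b := b * a)

/-- A transformation that commutes with the transpositions of the coordinates and with `θ` is
diagonal, given by a continuous homomorphism. -/
theorem exists_monoidHom_of_commute {K : Type u} [Group K] [TopologicalSpace K]
    [IsTopologicalGroup K] [CompactSpace K] [T2Space K] [SecondCountableTopology K]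
    [MeasurableSpace K] [BorelSpace K] (m : Measure K) [m.IsHaarMeasure] [IsProbabilityMeasure m]
    {T : (ℕ → K) → ℕ → K} (hT : MeasurePreserving T (powMeasure m) (powMeasure m))
    (hswap : ∀ i j : ℕ, ∀ᵐ x ∂powMeasure m, T (x ∘ Equiv.swap i j) = T x ∘ Equiv.swap i j)
    (hθ : ∀ᵐ x ∂powMeasure m, T (mulFirstEquiv K x) = mulFirstEquiv K (T x)) :
    ∃ β : K →* K, Continuous β ∧ ∀ᵐ x ∂powMeasure m, ∀ n, T x n = β (x n) := by
  let _ := TopologicalSpace.metrizableSpaceMetric K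
  obtain ⟨α, hα, h0⟩ := exists_eq_comp_eval_zero_of_swap_invariant m
    (F := fun x => T x 0) ((measurable_pi_apply 0).comp hT.measurable) fun i j hi hj => by
      filter_upwards [hswap i j] with x hx
      rw [hx, Function.comp_apply, Equiv.swap_apply_of_ne_of_ne hi.symm hj.symm]
  have hn : ∀ n, ∀ᵐ x ∂powMeasure m, T x n = α (x n) := by
    intro n
    have hq := (powMeasure_reindex_mp m (Equiv.swap 0 n).injective).quasiMeasurePreserving
    filter_upwards [hswap 0 n, hq.ae h0] with x h1 h2
    rw [h1] at h2
    simpa using h2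
  -- This is coordinate `0` of the commutation with `θ`, read on the independent pair `(x 0, x 1)`.
  have hmul : ∀ᵐ p ∂m.prod m, α (p.1 * p.2) = α p.1 * α p.2 := by
    refine (powMeasure_eval_pair_mp m zero_ne_one).ae_eq_of_ae_eq_comp
      (u := fun p => α (p.1 * p.2)) (v := fun p => α p.1 * α p.2)
      (by fun_prop) (by fun_prop) ?_
    filter_upwards [hθ, hn 0, hn 1, (mulFirst_mp m).quasiMeasurePreserving.ae h0] with x h1 h2 h3 h4
    rw [h1] at h4
    simpa [mulFirstEquiv, h2, h3] using h4.symm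
  obtain ⟨β, hβ, hαβ⟩ := exists_continuous_monoidHom_ae_eq m hα hmul
  refine ⟨β, hβ, ae_all_iff.2 fun n => ?_⟩
  filter_upwards [hn n, (powMeasure_eval_mp m n).quasiMeasurePreserving.ae hαβ] with x h1 h2
  exact h1.trans h2

/-- Both `T` and `T⁻¹` are diagonal, given by continuous homomorphisms. These are inverse to each
other almost everywhere, hence everywhere, since Haar measure charges every nonempty open set. -/
theorem exists_autDiag_eq_of_commute {K : Type u} [Group K] [TopologicalSpace K]
    [IsTopologicalGroup K] [CompactSpace K] [T2Space K] [SecondCountableTopology K]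
    [MeasurableSpace K] [BorelSpace K] (m : Measure K) [m.IsHaarMeasure] [IsProbabilityMeasure m]
    {T : AutMP (powMeasure m)}
    (hswap : ∀ i j : ℕ, T * coordPerm m (Equiv.swap i j) = coordPerm m (Equiv.swap i j) * T)
    (hθ : T * mulFirst m = mulFirst m * T) :
    ∃ β : autGroup K, autDiag m β = T := by
  have hswap' : ∀ i j : ℕ,
      T⁻¹ * coordPerm m (Equiv.swap i j) = coordPerm m (Equiv.swap i j) * T⁻¹ := fun i j =>
    (Commute.inv_left (hswap i j) :)
  have hθ' : T⁻¹ * mulFirst m = mulFirst m * T⁻¹ := (Commute.inv_left hθ :)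
  induction T using QuotientGroup.induction_on with
  | H t =>
    obtain ⟨β, hβ, hT⟩ := exists_monoidHom_of_commute m t.2.1
      (fun i j => AutMP.commute_mk_iff.1 (hswap i j)) (AutMP.commute_mk_iff.1 hθ)
    obtain ⟨γ, hγ, hT'⟩ := exists_monoidHom_of_commute m t.2.2
      (fun i j => (AutMP.commute_mk_iff (a := t⁻¹)).1 (hswap' i j))
      ((AutMP.commute_mk_iff (a := t⁻¹)).1 hθ')
    have hcancel : ∀ {s : (ℕ → K) → ℕ → K} {r : (ℕ → K) → ℕ → K} {b c : K →* K},
        Continuous b → Continuous c → MeasurePreserving r (powMeasure m) (powMeasure m) →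
        (∀ x, s (r x) = x) → (∀ᵐ x ∂powMeasure m, ∀ n, s x n = b (x n)) →
        (∀ᵐ x ∂powMeasure m, ∀ n, r x n = c (x n)) → ∀ k, b (c k) = k := by
      intro s r b c hb hc hr hsr hs hrc
      have hae : ∀ᵐ k ∂m, b (c k) = k := by
        refine (powMeasure_eval_mp m 0).ae_eq_of_ae_eq_comp (u := fun k => b (c k))
          (v := fun k => k) (hb.comp hc).measurable measurable_id ?_
        filter_upwards [hrc, hr.quasiMeasurePreserving.ae hs] with x h1 h2
        rw [← h1, ← h2, hsr]
      exact congrFun ((Continuous.ae_eq_iff_eq m (hb.comp hc) continuous_id).1 hae)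
    refine ⟨⟨⟨⟨β, γ, hcancel hγ hβ t.2.1 t.1.symm_apply_apply hT' hT,
      hcancel hβ hγ t.2.2 t.1.apply_symm_apply hT hT'⟩, hβ, hγ⟩, map_mul β⟩, ?_⟩
    refine AutMP.mk_eq_mk_iff.2 ?_
    filter_upwards [hT] with x hx
    exact funext fun n => (hx n).symm

theorem autDiag_commute_coordPerm {K : Type u} [Group K] [TopologicalSpace K]
    [IsTopologicalGroup K] [CompactSpace K] [MeasurableSpace K] [BorelSpace K]
    (m : Measure K) [m.IsHaarMeasure] [IsProbabilityMeasure m] (β : autGroup K)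
    (σ : Equiv.Perm ℕ) : autDiag m β * coordPerm m σ = coordPerm m σ * autDiag m β :=
  AutMP.commute_mk_iff.2 (Filter.Eventually.of_forall fun _ => rfl)

theorem autDiag_commute_mulFirst {K : Type u} [Group K] [TopologicalSpace K]
    [IsTopologicalGroup K] [CompactSpace K] [SecondCountableTopology K] [MeasurableSpace K]
    [BorelSpace K] (m : Measure K) [m.IsHaarMeasure] [IsProbabilityMeasure m] (β : autGroup K) :
    autDiag m β * mulFirst m = mulFirst m * autDiag m β := by
  refine AutMP.commute_mk_iff.2 (Filter.Eventually.of_forall fun x => funext fun n => ?_)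
  change β.1 (if n = 0 then x 0 * x 1 else x n) =
    if n = 0 then β.1 (x 0) * β.1 (x 1) else β.1 (x n)
  split_ifs
  · exact β.2 _ _
  · rfl

/-- The homomorphism `β ↦ φ_β`. -/
noncomputable def autDiagHom {K : Type u} [Group K] [TopologicalSpace K]
    [IsTopologicalGroup K] [CompactSpace K] [MeasurableSpace K] [BorelSpace K]
    (m : Measure K) [m.IsHaarMeasure] [IsProbabilityMeasure m] :
    autGroup K →* AutMP (powMeasure m) :=
  MonoidHom.mk' (autDiag m) fun _ _ => rfl

theorem autDiagHom_injective {K : Type u} [Group K] [TopologicalSpace K]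
    [IsTopologicalGroup K] [CompactSpace K] [T2Space K] [SecondCountableTopology K]
    [MeasurableSpace K] [BorelSpace K] (m : Measure K) [m.IsHaarMeasure]
    [IsProbabilityMeasure m] : Function.Injective (autDiagHom m) := by
  let _ := TopologicalSpace.metrizableSpaceMetric K
  intro β γ h
  have h1 : ∀ᵐ x ∂powMeasure m, (fun n => β.1 (x n)) = fun n => γ.1 (x n) :=
    AutMP.mk_eq_mk_iff.1 h
  have h2 : ∀ᵐ k ∂m, β.1 k = γ.1 k :=
    (powMeasure_eval_mp m 0).ae_eq_of_ae_eq_comp β.1.continuous.measurable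
      γ.1.continuous.measurable (h1.mono fun x hx => congrFun hx 0)
  have h3 := (Continuous.ae_eq_iff_eq m β.1.continuous γ.1.continuous).1 h2
  exact Subtype.ext (Homeomorph.ext (congrFun h3))

/-- The subgroups of `Aut_mp` generated by `θ` and sufficiently many permutations have the same
centralizer. -/
theorem mem_centralizer_iff_mem_range_autDiagHom {K : Type u} [Group K] [TopologicalSpace K]
    [IsTopologicalGroup K] [CompactSpace K] [T2Space K] [SecondCountableTopology K]
    [MeasurableSpace K] [BorelSpace K] (m : Measure K) [m.IsHaarMeasure] [IsProbabilityMeasure m]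
    {S : Set (AutMP (powMeasure m))} (hswap : ∀ i j : ℕ, coordPerm m (Equiv.swap i j) ∈ S)
    (hθ : mulFirst m ∈ S) (hS : S ⊆ permMulGroup m) (T : AutMP (powMeasure m)) :
    T ∈ Subgroup.centralizer S ↔ T ∈ (autDiagHom m).range := by
  constructor
  · intro hT
    rw [Subgroup.mem_centralizer_iff] at hT
    exact exists_autDiag_eq_of_commute m (fun i j => (hT _ (hswap i j)).symm) (hT _ hθ).symm
  · rintro ⟨β, rfl⟩
    refine Subgroup.centralizer_le hS ?_
    rw [permMulGroup, Subgroup.centralizer_closure, Subgroup.mem_centralizer_iff]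
    rintro _ (⟨σ, rfl⟩ | rfl)
    · exact (autDiag_commute_coordPerm m β σ).symm
    · exact (autDiag_commute_mulFirst m β).symm

/-! ### Comparison of the uniform and weak topologies -/

theorem AutMP.continuous_dist {X : Type u} [MeasurableSpace X] {μ : Measure X} {A B : Set X}
    (hA : MeasurableSet A) (hB : MeasurableSet B) :
    Continuous (AutMP.dist A B : AutMP μ → ℝ≥0∞) :=
  continuous_iff_le_induced.2 (iInf_le_of_le ⟨A, hA⟩ (iInf_le_of_le ⟨B, hB⟩ le_rfl))

open Filter Topology in
theorem tendsto_measure_symmDiff_right {X ι : Type*} [MeasurableSpace X] {μ : Measure X}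
    [IsFiniteMeasure μ] {l : Filter ι} {P : ι → Set X} {Q : Set X}
    (h : Tendsto (fun i => μ (P i ∆ Q)) l (𝓝 0)) (B : Set X) :
    Tendsto (fun i => μ (P i ∆ B)) l (𝓝 (μ (Q ∆ B))) := by
  have hlow : Tendsto (fun i => μ (Q ∆ B) - μ (P i ∆ Q)) l (𝓝 (μ (Q ∆ B))) := by
    simpa using ENNReal.Tendsto.sub (tendsto_const_nhds (x := μ (Q ∆ B))) h
      (Or.inl (measure_ne_top _ _))
  have hup : Tendsto (fun i => μ (P i ∆ Q) + μ (Q ∆ B)) l (𝓝 (μ (Q ∆ B))) := by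
    simpa using h.add_const (μ (Q ∆ B))
  refine tendsto_of_tendsto_of_tendsto_of_le_of_le hlow hup (fun i => ?_)
    fun i => measure_symmDiff_le _ _ _
  rw [tsub_le_iff_left, symmDiff_comm (P i) Q]
  exact measure_symmDiff_le _ _ _

/-- The diagonal map `x ↦ (β (x n))_n`, as a continuous map. -/
def diagContinuousMap {K : Type u} [TopologicalSpace K] (β : C(K, K)) : C(ℕ → K, ℕ → K) :=
  ⟨fun x n => β (x n), by fun_prop⟩

theorem continuous_diagContinuousMap {K : Type u} [TopologicalSpace K] [LocallyCompactSpace K] :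
    Continuous (diagContinuousMap (K := K)) := by
  refine ContinuousMap.continuous_of_continuous_uncurry _ ?_
  change Continuous fun p : C(K, K) × (ℕ → K) => fun n => p.1 (p.2 n)
  fun_prop

-- If continuous measure preserving maps converge in the compact-open topology, the preimages of a
-- fixed measurable set converge in measure. By `tendsto_measure_symmDiff_right` this is all the
-- weak topology asks for.
open Filter Topology in
theorem continuous_autDiagHom {K : Type u} [Group K] [TopologicalSpace K]
    [IsTopologicalGroup K] [CompactSpace K] [T2Space K] [SecondCountableTopology K]
    [MeasurableSpace K] [BorelSpace K] (m : Measure K) [m.IsHaarMeasure]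
    [IsProbabilityMeasure m] : Continuous (autDiagHom m) := by
  refine continuous_iInf_rng.2 fun A => continuous_iInf_rng.2 fun B => continuous_induced_rng.2 ?_
  refine continuous_iff_continuousAt.2 fun β => tendsto_measure_symmDiff_right
    (μ := powMeasure m) (P := fun γ : autGroup K => diagContinuousMap (γ.1 : C(K, K)) ⁻¹' A.1)
    (Q := diagContinuousMap (β.1 : C(K, K)) ⁻¹' A.1) ?_ B.1
  have hc : Continuous fun γ : autGroup K => diagContinuousMap (γ.1 : C(K, K)) :=
    continuous_diagContinuousMap.comp (isInducing_autGroupToProd K).continuous.fst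
  have hmp : ∀ γ : autGroup K, MeasurePreserving (diagContinuousMap (γ.1 : C(K, K)))
      (powMeasure m) (powMeasure m) := fun γ => diag_mp _ (autGroup_mp m γ)
  exact tendsto_measure_symmDiff_preimage_nhds_zero (hc.tendsto β) (Eventually.of_forall hmp)
    (hmp β) A.2.nullMeasurableSet (measure_ne_top _ _)

theorem dist_autDiagHom {K : Type u} [Group K] [TopologicalSpace K]
    [IsTopologicalGroup K] [CompactSpace K] [MeasurableSpace K] [BorelSpace K]
    (m : Measure K) [m.IsHaarMeasure] [IsProbabilityMeasure m] {A B : Set K}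
    (hA : MeasurableSet A) (hB : MeasurableSet B) (β : autGroup K) :
    AutMP.dist ((fun x : ℕ → K => x 0) ⁻¹' A) ((fun x : ℕ → K => x 0) ⁻¹' B) (autDiagHom m β) =
      m ((β.1 ⁻¹' A) ∆ B) :=
  (powMeasure_eval_mp m 0).measure_preimage
    (((β.1.continuous.measurable hA).symmDiff hB).nullMeasurableSet)

-- Testing weak convergence on cylinder sets over coordinate `0` gives convergence in measure on
-- `K`, which `tendsto_autGroup_of_tendsto_measure` upgrades to uniform convergence, for the
-- automorphisms and for their inverses.
open Filter Topology in
theorem isInducing_autDiagHom {K : Type u} [Group K] [TopologicalSpace K]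
    [IsTopologicalGroup K] [CompactSpace K] [T2Space K] [SecondCountableTopology K]
    [MeasurableSpace K] [BorelSpace K] (m : Measure K) [m.IsHaarMeasure]
    [IsProbabilityMeasure m] : IsInducing (autDiagHom m) := by
  refine isInducing_iff_nhds.2 fun β => le_antisymm
    (continuous_autDiagHom m).continuousAt.le_comap ?_
  have hev := measurable_pi_apply (X := fun _ : ℕ => K) 0
  have hdist : ∀ A B : Set K, MeasurableSet A → MeasurableSet B →
      Tendsto (fun γ : autGroup K => m ((γ.1 ⁻¹' A) ∆ B))
        (comap (autDiagHom m) (𝓝 (autDiagHom m β))) (𝓝 (m ((β.1 ⁻¹' A) ∆ B))) := by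
    intro A B hA hB
    simp only [← dist_autDiagHom m hA hB]
    exact ((AutMP.continuous_dist (hev hA) (hev hB)).tendsto _).comp tendsto_comap
  refine tendsto_id'.1 ((isInducing_autGroupToProd K).tendsto_nhds_iff.2 (Tendsto.prodMk_nhds ?_ ?_))
  · refine tendsto_autGroup_of_tendsto_measure m fun A hA => ?_
    simpa using hdist A (β.1 ⁻¹' A) hA (β.1.continuous.measurable hA)
  · refine tendsto_autGroup_of_tendsto_measure m (f := fun γ => γ⁻¹) (g := β⁻¹) fun A hA => ?_
    have hA' := β.1.symm.continuous.measurable hA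
    -- As `γ` preserves `m`, the measure of `γ(A) ∆ β(A)` equals that of `A ∆ γ⁻¹(β(A))`, so the
    -- distances in `hdist` also control the inverses.
    have h := hdist (β.1.symm ⁻¹' A) A hA' hA
    have h0 : (β.1 ⁻¹' (β.1.symm ⁻¹' A)) ∆ A = ∅ := by
      simp [← Set.preimage_comp]
    rw [h0, measure_empty] at h
    refine h.congr fun γ => ?_
    have hγ := (autGroup_mp m γ).measure_preimage
      ((γ.1.symm.continuous.measurable hA).symmDiff hA').nullMeasurableSet
    change _ = m ((γ.1.symm ⁻¹' A) ∆ (β.1.symm ⁻¹' A))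
    rw [← hγ, symmDiff_comm]
    congr 1
    ext x
    simp [Set.mem_symmDiff]

/-! ### The isomorphism and the countable ergodic action -/

/-- The isomorphism of `Aut K` with a subgroup of `Aut_mp` that consists of the transformations
`φ_β`. -/
theorem exists_continuousMulEquiv_of_mem_iff {K : Type u} [Group K] [TopologicalSpace K]
    [IsTopologicalGroup K] [CompactSpace K] [T2Space K] [SecondCountableTopology K]
    [MeasurableSpace K] [BorelSpace K] (m : Measure K) [m.IsHaarMeasure] [IsProbabilityMeasure m]
    {C : Subgroup (AutMP (powMeasure m))} (hC : ∀ T, T ∈ C ↔ T ∈ (autDiagHom m).range) :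
    ∃ e : autGroup K ≃ₜ* C, ∀ β : autGroup K, (e β : AutMP (powMeasure m)) = autDiag m β := by
  let f : autGroup K →* C := (autDiagHom m).codRestrict C fun β => (hC _).2 ⟨β, rfl⟩
  have hf : Function.Bijective f := by
    refine ⟨fun β γ h => autDiagHom_injective m (congrArg Subtype.val h), fun T => ?_⟩
    obtain ⟨β, hβ⟩ := (hC T.1).1 T.2
    exact ⟨β, Subtype.ext hβ⟩
  have hi : Topology.IsInducing f :=
    Topology.IsInducing.of_comp_iff Topology.IsInducing.subtypeVal |>.1 (isInducing_autDiagHom m)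
  let h := (Equiv.ofBijective f hf).toHomeomorphOfIsInducing hi
  exact ⟨{ MulEquiv.ofBijective f hf with
    continuous_toFun := h.continuous
    continuous_invFun := h.symm.continuous }, fun _ => rfl⟩

theorem Subgroup.countable_closure {G : Type*} [Group G] {s : Set G} (hs : s.Countable) :
    Countable (Subgroup.closure s) := by
  have : Countable s := hs
  have : Countable (FreeGroup s) := inferInstanceAs (Countable (Quot _))
  rw [FreeGroup.closure_eq_range]
  exact (FreeGroup.lift ((↑) : s → G)).rangeRestrict_surjective.countable

/-- The group of transformations of `K^ℕ` generated by the transpositions of the coordinates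
and `θ`. -/
noncomputable def swapMulGroup {K : Type u} [Group K] [MeasurableSpace K] [MeasurableMul₂ K]
    [MeasurableInv K] (m : Measure K) [IsProbabilityMeasure m] [m.IsMulRightInvariant] :
    Subgroup (mpPerm (powMeasure m)) :=
  Subgroup.closure (Set.range (fun p : ℕ × ℕ =>
    (⟨(coordPermEquiv K (Equiv.swap p.1 p.2)).toEquiv, coordPerm_mp m _,
      (coordPerm_mp m _).symm _⟩ : mpPerm (powMeasure m))) ∪
    {⟨(mulFirstEquiv K).toEquiv, mulFirst_mp m, (mulFirst_mp m).symm _⟩})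

theorem swapMulGroup_countable {K : Type u} [Group K] [MeasurableSpace K] [MeasurableMul₂ K]
    [MeasurableInv K] (m : Measure K) [IsProbabilityMeasure m] [m.IsMulRightInvariant] :
    Countable (swapMulGroup m) :=
  Subgroup.countable_closure ((Set.countable_range _).union (Set.countable_singleton _))

/-- The group of all permutations of `ℕ` is uncountable, so the acting group is the countable
`swapMulGroup`. It is formed in `mpPerm`, before passing to classes, in order to act on points;
ergodicity already holds for the transpositions. -/
theorem autGroup_isCentralizerGroup {K : Type u} [Group K] [TopologicalSpace K]
    [IsTopologicalGroup K] [CompactSpace K] [T2Space K] [SecondCountableTopology K]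
    [MeasurableSpace K] [BorelSpace K] (m : Measure K) [m.IsHaarMeasure]
    [IsProbabilityMeasure m] : IsCentralizerGroup (autGroup K) := by
  let _ := TopologicalSpace.metrizableSpaceMetric K
  have hmeas : MeasurableConstSMul (swapMulGroup m) (ℕ → K) := ⟨fun g => g.1.2.1.measurable⟩
  have hmem : ∀ p : ℕ × ℕ, (⟨(coordPermEquiv K (Equiv.swap p.1 p.2)).toEquiv, coordPerm_mp m _,
      (coordPerm_mp m _).symm _⟩ : mpPerm (powMeasure m)) ∈ swapMulGroup m := fun p =>
    Subgroup.subset_closure (Or.inl ⟨p, rfl⟩)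
  have hθ : (⟨(mulFirstEquiv K).toEquiv, mulFirst_mp m, (mulFirst_mp m).symm _⟩ :
      mpPerm (powMeasure m)) ∈ swapMulGroup m := Subgroup.subset_closure (Or.inr rfl)
  have herg : ErgodicSMul (swapMulGroup m) (ℕ → K) (powMeasure m) :=
    { measure_preimage_smul := fun g s hs => g.1.2.1.measure_preimage hs.nullMeasurableSet
      aeconst_of_forall_preimage_smul_ae_eq := fun hs h =>
        eventuallyConst_of_swap_invariant m hs fun i j => h ⟨_, hmem (i, j)⟩ }
  refine ⟨autGroup_isTopologicalGroup K, autGroup_polishSpace K, ℕ → K, inferInstance,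
    inferInstance, powMeasure m, inferInstance, swapMulGroup m, inferInstance,
    swapMulGroup_countable m, inferInstance, hmeas, herg, ?_⟩
  -- The classes of the acting group lie in `permMulGroup m`, hence commute with every `φ_β`.
  have hle : swapMulGroup m ≤
      (permMulGroup m).comap (QuotientGroup.mk' (aeTrivial (powMeasure m))) := by
    rw [swapMulGroup, Subgroup.closure_le]
    rintro _ (⟨p, rfl⟩ | rfl)
    · exact Subgroup.subset_closure (Or.inl ⟨_, rfl⟩)
    · exact Subgroup.subset_closure (Or.inr rfl)
  obtain ⟨e, -⟩ := exists_continuousMulEquiv_of_mem_iff m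
    (mem_centralizer_iff_mem_range_autDiagHom m
      (S := Set.range (AutMP.ofSMul (Λ := swapMulGroup m) (powMeasure m)))
      (fun i j => ⟨⟨_, hmem (i, j)⟩, rfl⟩) ⟨⟨_, hθ⟩, rfl⟩
      (by rintro _ ⟨g, rfl⟩; exact hle g.2))
  exact ⟨e⟩

theorem mainTheorem4 {K : Type*} [Group K] [TopologicalSpace K] [IsTopologicalGroup K]
    [CompactSpace K] [T2Space K] [SecondCountableTopology K] [MeasurableSpace K] [BorelSpace K]
    (m : Measure K) [m.IsHaarMeasure] [IsProbabilityMeasure m] :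
    IsCentralizerGroup (autGroup K) ∧
    ∃ e : autGroup K ≃ₜ* Subgroup.centralizer (permMulGroup m : Set (AutMP (powMeasure m))),
      ∀ β : autGroup K, (e β : AutMP (powMeasure m)) = autDiag m β :=
  ⟨autGroup_isCentralizerGroup m, exists_continuousMulEquiv_of_mem_iff m
    (mem_centralizer_iff_mem_range_autDiagHom m
      (fun _ _ => Subgroup.subset_closure (Or.inl ⟨_, rfl⟩))
      (Subgroup.subset_closure (Or.inr rfl)) subset_rfl)⟩
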